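/- Let $n\ge 1$. Consider Boolean variables $x_{ij}$ together with their twin variables $\bar x_{ij}$, for $i\in[n]$, $j\in[2n]$. Let $\mathrm{ks}_i=\sum_{j\in[2n]}x_{ij}-n$, and let $Q_n$ be the set of the following polynomial constraints: $\mathrm{ks}_1-\tfrac12=0$; $\mathrm{ks}_i^2-\mathrm{ks}_{i+1}=0$ for each $i\in[n-1]$; and $\mathrm{ks}_n^2=0$. An SOS refutation of $Q_n$ with rational coefficients is a polynomial identity $$-1=\sum_{l\in[k]} r_l^2+\sum_{q\in Q_n}t_q\,q+\sum_{i\in[n],\,j\in[2n]}\bigl(u_{ij}(x_{ij}^2-x_{ij})+v_{ij}(x_{ij}+\bar x_{ij}-1)\bigr),$$ where $k\ge 0$ and $r_l,t_q,u_{ij},v_{ij}$ are arbitrary polynomials with rational coefficients in the variables $x_{ij},\bar x_{ij}$. Its bit-complexity is the minimum length of a bit-string that represents it, i.e. that lists all the polynomials $r_l,t_q,u_{ij},v_{ij}$, each one as the list of its monomials with their nonzero coefficients. Monomials are written in a fixed prefix-free binary code. Each coefficient is written as a sign and the numerator and denominator of its reduced fraction, in (self-delimiting) binary. Then every SOS refutation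 of $Q_n$ with rational coefficients has bit-complexity $2^{\Omega(n)}$. That is, there are constants $c>0$ and $N$ such that for every $n\ge N$, every prefix-free binary code for the monomials, and every SOS refutation of $Q_n$ with rational coefficients, the bit-complexity of the refutation is at least $2^{cn}$. -/

import Mathlib

namespace SOSBits

/-- Monomials in the twin variables: `Sum.inl a` is the variable `x_a`, and `Sum.inr a` is its
twin `x̄_a`. -/
abbrev Monom (σ : Type) := (σ ⊕ σ) →₀ ℕ

/-- Rational polynomials in the twin variables `x_a`, `x̄_a`, for `a : σ`. -/
abbrev Poly (σ : Type) := MvPolynomial (σ ⊕ σ) ℚ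

/-- The variable `x_a`. -/
noncomputable def x {σ : Type} (a : σ) : Poly σ := MvPolynomial.X (Sum.inl a)

/-- The twin variable `x̄_a`. -/
noncomputable def xbar {σ : Type} (a : σ) : Poly σ := MvPolynomial.X (Sum.inr a)

/-- An SOS refutation (with rational coefficients) of the set of constraints `q = 0`, `q ∈ Q`:
a polynomial identity
`-1 = ∑ r_i ^ 2 + ∑_q t_q q + ∑_a (u_a (x_a ^ 2 - x_a) + v_a (x_a + x̄_a - 1))`. -/
structure SOSRefutation {σ : Type} [Fintype σ] (Q : Finset (Poly σ)) where
  /-- The polynomials `r_1, …, r_k` that are squared. -/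
  r : List (Poly σ)
  /-- The lifts of the non-logical axioms. -/
  t : {q // q ∈ Q} → Poly σ
  /-- The lifts of the logical axioms `x_a ^ 2 - x_a`. -/
  u : σ → Poly σ
  /-- The lifts of the logical axioms `x_a + x̄_a - 1`. -/
  v : σ → Poly σ
  identity :
    (-1 : Poly σ) = (r.map fun p => p ^ 2).sum + ∑ q : {q // q ∈ Q}, t q * q.1
      + ∑ a, (u a * (x a ^ 2 - x a) + v a * (x a + xbar a - 1))

/-! ### Bit-strings -/

/-- The binary numeral of `k` (least significant digit first), made self-delimiting: every digit
is preceded by `1`, and the numeral is closed by `0`. -/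
def natCode (k : ℕ) : List Bool := (k.bits.flatMap fun b => [true, b]) ++ [false]

/-- A rational number, written as its reduced fraction in binary: a sign bit, the absolute value
of the numerator, the denominator. -/
def ratCode (a : ℚ) : List Bool := decide (a < 0) :: (natCode a.num.natAbs ++ natCode a.den)

/-- A way to write monomials as bit-strings such that no codeword is a prefix of another. -/
def IsPrefixCode {σ : Type} (code : Monom σ → List Bool) : Prop :=
  ∀ m m' : Monom σ, code m <+: code m' → m = m'

/-- The bit-string `w` represents the polynomial `p`: it lists, in some order and without
repetition, the monomials of `p`, each with its coefficient. The bit `1` announces a further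
term, the bit `0` the end of the list. -/
def PolyRep {σ : Type} (code : Monom σ → List Bool) (w : List Bool) (p : Poly σ) : Prop :=
  ∃ ms : List (Monom σ), ms.Nodup ∧ (∀ m, m ∈ ms ↔ m ∈ p.support) ∧
    w = (ms.flatMap fun m => true :: (code m ++ ratCode (p.coeff m))) ++ [false]

/-- The bit-string `w` represents the refutation `π`: it consists of representations of all the
`r_i` (each announced by the bit `1`, and the list closed by the bit `0`), followed by
representations of all the lifts. The axioms are fixed by `Q`, and no bits are spent on them. -/
def Represents {σ : Type} [Fintype σ] {Q : Finset (Poly σ)} (code : Monom σ → List Bool)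
    (w : List Bool) (π : SOSRefutation Q) : Prop :=
  ∃ (wr : List (List Bool)) (wt : {q // q ∈ Q} → List Bool) (wu wv : σ → List Bool),
    List.Forall₂ (PolyRep code) wr π.r ∧
    (∀ q, PolyRep code (wt q) (π.t q)) ∧
    (∀ a, PolyRep code (wu a) (π.u a)) ∧
    (∀ a, PolyRep code (wv a) (π.v a)) ∧
    w = (wr.flatMap fun s => true :: s) ++ [false]
      ++ (Finset.univ : Finset {q // q ∈ Q}).toList.flatMap wt
      ++ (Finset.univ : Finset σ).toList.flatMap wu
      ++ (Finset.univ : Finset σ).toList.flatMap wv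

/-- The bit-complexity of a refutation: the minimum length of a bit-string representing it. -/
noncomputable def SOSRefutation.bitComplexity {σ : Type} [Fintype σ] {Q : Finset (Poly σ)}
    (code : Monom σ → List Bool) (π : SOSRefutation Q) : ℕ :=
  sInf {l : ℕ | ∃ w : List Bool, Represents code w π ∧ w.length = l}

theorem exists_polyRep {σ : Type} (code : Monom σ → List Bool) (p : Poly σ) :
    ∃ w, PolyRep code w p :=
  ⟨_, p.support.toList, Finset.nodup_toList _, fun _ => Finset.mem_toList, rfl⟩

theorem exists_represents {σ : Type} [Fintype σ] {Q : Finset (Poly σ)}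
    (code : Monom σ → List Bool) (π : SOSRefutation Q) : ∃ w, Represents code w π := by
  choose f hf using exists_polyRep code
  refine ⟨_, π.r.map f, fun q => f (π.t q), fun a => f (π.u a), fun a => f (π.v a), ?_,
    fun q => hf _, fun a => hf _, fun a => hf _, rfl⟩
  rw [List.forall₂_map_left_iff]
  exact List.forall₂_same.2 fun p _ => hf p

/-- The minimum in the definition of the bit-complexity is attained. -/
theorem SOSRefutation.bitComplexity_spec {σ : Type} [Fintype σ] {Q : Finset (Poly σ)}
    (code : Monom σ → List Bool) (π : SOSRefutation Q) :
    ∃ w, Represents code w π ∧ w.length = π.bitComplexity code := by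
  obtain ⟨w, hw⟩ := exists_represents code π
  exact Nat.sInf_mem (s := {l : ℕ | ∃ w : List Bool, Represents code w π ∧ w.length = l})
    ⟨_, w, hw, rfl⟩

/-! ### The constraints -/

/-- The index set of the variables `x_{ij}`, `i ∈ [n]`, `j ∈ [2n]` (here counted from zero). -/
abbrev Idx (n : ℕ) := Fin n × Fin (2 * n)

/-- The polynomial `ks_i = ∑_{j ∈ [2n]} x_{ij} - n`. -/
noncomputable def ks {n : ℕ} (i : Fin n) : Poly (Idx n) :=
  (∑ j : Fin (2 * n), x (i, j)) - MvPolynomial.C (n : ℚ)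

open Classical in
/-- The set of constraints `Q_n`: `ks_1 - 1/2`; `ks_i ^ 2 - ks_{i+1}` for consecutive indices;
and `ks_n ^ 2` (indices counted from zero in the code). -/
noncomputable def Q (n : ℕ) : Finset (Poly (Idx n)) :=
  ((Finset.univ.filter fun i : Fin n => i.val = 0).image
      fun i => ks i - MvPolynomial.C (1 / 2 : ℚ)) ∪
    ((Finset.univ.filter fun p : Fin n × Fin n => p.2.val = p.1.val + 1).image
      fun p => ks p.1 ^ 2 - ks p.2) ∪
    ((Finset.univ.filter fun i : Fin n => i.val + 1 = n).image fun i => ks i ^ 2)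

end SOSBits

namespace SOSBits

/-! The constraints come close to being satisfiable: assigning `ks_i` the value `ksValue i`, which
is 2^(-2^i) with indices from zero, satisfies all of them except the last, which is off by only
2^(-2^n). Suppose a linear functional E with E 1 = 1 behaves as if the `ks_i` had these values,
respects the logical axioms and is nonnegative on the squares of the refutation. Applying E to the
identity leaves the lift of the last constraint to produce -1 out of a factor 2^(-2^n), so the lifts
have coefficients of total size at least 2^(2^n) (`two_pow_le_sum_abs_coeff`), once E is known to
have absolute value at most 1 on every monomial.

Such an E is a product over the rows of symmetric knapsack functionals, whose moments are ratios of
falling factorials. It is nonnegative on squares of polynomials with few distinct variables per row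
(`pseudoExp_sq_nonneg`): each row has an explicit Gram decomposition, which follows from a
Chu–Vandermonde identity, and Gram decompositions multiply over rows. A restricted monomial f is
idempotent modulo the Boolean axioms, so squares of f and 1 - f give 0 ≤ E f ≤ 1
(`abs_pseudoExp_restrict_le`).

No degree bound is given, so one is enforced by a restriction (`exists_restriction`). Each row is
cut into blocks of four variables; in every block one variable is set to 0 and its neighbour to 1.
This keeps the knapsack balanced, and for each variable and each value one of the four choices per
block gives it that value, so monomials in twin variables are killed as well. A monomial touching D
blocks survives a fraction at most (3/4)^D of the choices, and a union bound handles exponentially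
many monomials.

Hence a refutation has either exponentially many monomials or coefficients so large that writing
them takes exponentially many bits (`two_pow_le_length`). -/

/-! ### The knapsack moments -/

/-- The moment `(a)_k / (N)_k` (a ratio of falling factorials): the pseudo-expectation of a product
of `k` distinct Boolean variables out of `N`, subject to the sum of all the variables being `a`. -/
def knapsackMoment (N : ℕ) (a : ℚ) (k : ℕ) : ℚ :=
  ∏ i ∈ Finset.range k, (a - i) / (N - i)

/-- A form of the Chu–Vandermonde identity. The left side P(i; A, δ) satisfies P(i+1; A, δ) = P(i;
A, δ) + (δ/A) P(i; A+1, δ-1), and by Pascal's rule so does the right side. -/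
theorem prod_add_div_eq_sum_choose (i : ℕ) (A δ : ℚ) (hA : 0 < A) :
    ∏ l ∈ Finset.range i, (A + δ + l) / (A + l) =
      ∑ j ∈ Finset.range (i + 1), (i.choose j : ℚ) * ∏ l ∈ Finset.range j, (δ - l) / (A + l) := by
  induction i generalizing A δ with
  | zero => simp
  | succ i ih =>
    have pos : ∀ l : ℕ, (A + l) ≠ 0 := fun l => by positivity
    have shift : ∀ j : ℕ, ∏ l ∈ Finset.range (j + 1), (δ - l) / (A + l) =
        δ / A * ∏ l ∈ Finset.range j, (δ - 1 - l) / (A + 1 + l) := by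
      intro j
      rw [Finset.prod_range_succ', mul_comm]
      push_cast
      rw [sub_zero, add_zero]
      congr 1
      refine Finset.prod_congr rfl fun l _ => ?_
      congr 1 <;> ring
    have tele : ∀ k : ℕ, (∏ l ∈ Finset.range k, (A + 1 + (δ - 1) + l) / (A + 1 + l)) * (A + k) =
        A * ∏ l ∈ Finset.range k, (A + δ + l) / (A + l) := by
      intro k
      induction k with
      | zero => simp
      | succ k ihk =>
        rw [Finset.prod_range_succ, Finset.prod_range_succ, ← mul_assoc, ← ihk]
        have h1 := pos k
        have h2 := pos (k + 1)
        push_cast at h2 ⊢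
        have h3 : A + 1 + (k : ℚ) ≠ 0 := by
          intro h; apply h2; linarith
        field_simp
        ring
    have hA0 : A ≠ 0 := hA.ne'
    have key : ∏ l ∈ Finset.range (i + 1), (A + δ + l) / (A + l) =
        ∏ l ∈ Finset.range i, (A + δ + l) / (A + l) +
          δ / A * ∏ l ∈ Finset.range i, (A + 1 + (δ - 1) + l) / (A + 1 + l) := by
      have h1 := pos i
      have := tele i
      rw [← eq_div_iff h1] at this
      rw [this, Finset.prod_range_succ]
      field_simp
      ring
    rw [key, ih A δ hA, ih (A + 1) (δ - 1) (by linarith), Finset.sum_range_succ' _ (i + 1)]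
    simp only [Nat.choose_succ_succ, Nat.cast_add, add_mul, Finset.sum_add_distrib, shift]
    rw [Finset.mul_sum, Finset.sum_range_succ' _ i,
      Finset.sum_range_succ (fun j => (i.choose (j + 1) : ℚ) * _) i]
    simp only [shift, Nat.choose_succ_self, Nat.cast_zero, zero_mul, add_zero, Nat.choose_zero_right]
    have : ∀ j : ℕ, δ / A * ((i.choose j : ℚ) * ∏ l ∈ Finset.range j, (δ - 1 - l) / (A + 1 + l)) =
        (i.choose j : ℚ) * (δ / A * ∏ l ∈ Finset.range j, (δ - 1 - l) / (A + 1 + l)) :=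
      fun j => by ring
    simp only [this]
    ring

/-- Undoing the last factors of the moment gives a ratio of rising factorials, the shape needed for
`prod_add_div_eq_sum_choose`. -/
theorem knapsackMoment_sub {N k : ℕ} {a : ℚ} (hk : k ≤ N) (ha : 0 < a - k + 1) {i : ℕ}
    (hi : i ≤ k) :
    knapsackMoment N a (k - i) = knapsackMoment N a k *
      ∏ l ∈ Finset.range i, ((N : ℚ) - k + 1 + l) / (a - k + 1 + l) := by
  induction i with
  | zero => simp
  | succ i ih =>
    obtain ⟨r, rfl⟩ : ∃ r, k = r + (i + 1) := ⟨k - (i + 1), by omega⟩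
    have h1 := ih (by omega)
    rw [show r + (i + 1) - i = r + 1 by omega] at h1
    rw [show r + (i + 1) - (i + 1) = r by omega, Finset.prod_range_succ, ← mul_assoc, ← h1,
      knapsackMoment, knapsackMoment, Finset.prod_range_succ]
    have hN : (r : ℚ) + (i + 1) ≤ N := by exact_mod_cast hk
    have hi0 : (0 : ℚ) ≤ i := by positivity
    push_cast at ha ⊢
    have e1 : a - (r + (i + 1)) + 1 + (i : ℚ) = a - r := by ring
    have e2 : (N : ℚ) - (r + (i + 1)) + 1 + i = N - r := by ring
    have n1 : a - r ≠ 0 := by linarith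
    have n2 : (N : ℚ) - r ≠ 0 := by linarith
    rw [e1, e2]
    field_simp

theorem knapsackMoment_nonneg {N k : ℕ} {a : ℚ} (hk : k ≤ N) (ha : 0 < a - k + 1) :
    0 ≤ knapsackMoment N a k := by
  refine Finset.prod_nonneg fun i hi => ?_
  have h1 : (i : ℚ) + 1 ≤ k := by exact_mod_cast Finset.mem_range.1 hi
  have h2 : (k : ℚ) ≤ N := by exact_mod_cast hk
  exact div_nonneg (by linarith) (by linarith)

theorem knapsackMoment_succ {N k : ℕ} {a : ℚ} (hk : k < N) :
    ((N : ℚ) - k) * knapsackMoment N a (k + 1) = (a - k) * knapsackMoment N a k := by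
  rw [knapsackMoment, Finset.prod_range_succ, ← knapsackMoment]
  have : (N : ℚ) - k ≠ 0 := by
    have : (k : ℚ) < N := by exact_mod_cast hk
    linarith
  field_simp

/-! ### Gram decomposition of the moments of a single row. -/

section Row

variable {κ : Type} [DecidableEq κ]

/-- The functional sees the sum of all variables as `a`, and the variables of `S` are absorbed by
the product over `U`. Inserting `j` changes nothing for `j` in `U`, and raises the degree by one
otherwise. -/
theorem sum_knapsackMoment_insert {L S U : Finset κ} {a : ℚ} (hS : S ⊆ U) (hU : U ⊆ L)
    (hlt : U.card < L.card) :
    ∑ j ∈ L \ S, knapsackMoment L.card a (insert j U).card =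
      (a - S.card) * knapsackMoment L.card a U.card := by
  have h1 : ∑ j ∈ U \ S, knapsackMoment L.card a (insert j U).card =
      ((U.card : ℚ) - S.card) * knapsackMoment L.card a U.card := by
    rw [Finset.sum_congr rfl fun j hj => by
      rw [Finset.insert_eq_self.2 (Finset.mem_sdiff.1 hj).1], Finset.sum_const, nsmul_eq_mul,
      Finset.card_sdiff_of_subset hS, Nat.cast_sub (Finset.card_le_card hS)]
  have h2 : ∑ j ∈ L \ U, knapsackMoment L.card a (insert j U).card =
      ((L.card : ℚ) - U.card) * knapsackMoment L.card a (U.card + 1) := by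
    rw [Finset.sum_congr rfl fun j hj => by
      rw [Finset.card_insert_of_notMem (Finset.mem_sdiff.1 hj).2], Finset.sum_const, nsmul_eq_mul,
      Finset.card_sdiff_of_subset hU, Nat.cast_sub (Finset.card_le_card hU)]
  have h3 : L \ S = (U \ S) ∪ (L \ U) := by
    ext j
    have := @hS j
    have := @hU j
    simp only [Finset.mem_union, Finset.mem_sdiff]
    tauto
  have h4 : Disjoint (U \ S) (L \ U) :=
    Finset.disjoint_left.2 fun j h h' => (Finset.mem_sdiff.1 h').2 (Finset.mem_sdiff.1 h).1
  rw [h3, Finset.sum_union h4, h1, h2, knapsackMoment_succ hlt]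
  ring

/-- The weight of a set of `j` variables in the Gram decomposition of the knapsack moments of the
products of `d` variables. -/
def gramWeight (N : ℕ) (a : ℚ) (d j : ℕ) : ℚ :=
  if j ≤ d then knapsackMoment N a (2 * d) *
    ∏ l ∈ Finset.range j, ((N : ℚ) - a - l) / (a - (2 * d : ℕ) + 1 + l) else 0

theorem gramWeight_nonneg {N : ℕ} {a : ℚ} {d : ℕ} (hd : 2 * d ≤ N)
    (ha : 0 < a - (2 * d : ℕ) + 1) (hb : 0 ≤ (N : ℚ) - a - d) (j : ℕ) :
    0 ≤ gramWeight N a d j := by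
  rw [gramWeight]
  split_ifs with hj
  · refine mul_nonneg (knapsackMoment_nonneg hd ha) (Finset.prod_nonneg fun l hl => ?_)
    have h1 : (l : ℚ) ≤ d := by exact_mod_cast (Finset.mem_range.1 hl).le.trans hj
    have h2 : (0 : ℚ) ≤ l := by positivity
    exact div_nonneg (by linarith) (by linarith)
  · exact le_rfl

/-- The component at `A` of the Gram vector of the product of the variables in `S`, after `k` steps
of homogenization. -/
def gramVector (L : Finset κ) (a : ℚ) : ℕ → Finset κ → Finset κ → ℚ
  | 0, S, A => if A ⊆ S then 1 else 0
  | k + 1, S, A => (a - S.card)⁻¹ * ∑ j ∈ L \ S, gramVector L a k (insert j S) A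

theorem gramVector_succ (L : Finset κ) (a : ℚ) (k : ℕ) (S A : Finset κ) :
    gramVector L a (k + 1) S A = (a - S.card)⁻¹ * ∑ j ∈ L \ S, gramVector L a k (insert j S) A :=
  rfl

variable [Fintype κ]

/-- The union has 2d - |S ∩ T| elements, and Chu–Vandermonde expands its moment in the binomials
C(|S ∩ T|, j). Such a binomial counts the sets A of size j contained in both S and T, which is a sum
of products of indicators. -/
theorem knapsackMoment_union_of_card_eq {L S T : Finset κ} {a : ℚ} {d : ℕ} (hd : 2 * d ≤ L.card)
    (ha : 0 < a - (2 * d : ℕ) + 1) (hS : S.card = d) (hT : T.card = d) :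
    knapsackMoment L.card a (S ∪ T).card =
      ∑ A, gramWeight L.card a d A.card * gramVector L a 0 S A * gramVector L a 0 T A := by
  have hi : (S ∩ T).card ≤ d := hS ▸ Finset.card_le_card Finset.inter_subset_left
  have hu : (S ∪ T).card = 2 * d - (S ∩ T).card := by
    have := Finset.card_union_add_card_inter S T
    omega
  have h1 : ∀ A : Finset κ,
      gramWeight L.card a d A.card * gramVector L a 0 S A * gramVector L a 0 T A =
        if A ∈ (S ∩ T).powerset then gramWeight L.card a d A.card else 0 := by
    intro A
    simp only [gramVector, Finset.mem_powerset, Finset.subset_inter_iff]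
    split_ifs <;> simp_all
  rw [Finset.sum_congr rfl fun A _ => h1 A, Finset.sum_ite_mem, Finset.univ_inter,
    Finset.sum_powerset_apply_card, hu, knapsackMoment_sub hd ha (by omega)]
  have h2 := prod_add_div_eq_sum_choose (S ∩ T).card _ ((L.card : ℚ) - a) ha
  rw [show a - ((2 * d : ℕ) : ℚ) + 1 + ((L.card : ℚ) - a) = L.card - ((2 * d : ℕ) : ℚ) + 1 by ring]
    at h2
  rw [h2, Finset.mul_sum]
  refine Finset.sum_congr rfl fun j hj => ?_
  have : j ≤ d := by
    have := Finset.mem_range.1 hj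
    omega
  rw [gramWeight, if_pos this, nsmul_eq_mul]
  ring

theorem knapsackMoment_union {L : Finset κ} {a : ℚ} {d : ℕ} (hd : 2 * d ≤ L.card)
    (ha : 0 < a - (2 * d : ℕ) + 1) {k l : ℕ} {S T : Finset κ} (hSL : S ⊆ L) (hTL : T ⊆ L)
    (hS : S.card + k = d) (hT : T.card + l = d) :
    knapsackMoment L.card a (S ∪ T).card =
      ∑ A, gramWeight L.card a d A.card * gramVector L a k S A * gramVector L a l T A := by
  -- Homogenization: a product of fewer than `d` variables is replaced by an average of its
  -- one-variable extensions. Both index sets are raised to size `d` this way, mirroring the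
  -- recursion of `gramVector`.
  have step : ∀ {S T : Finset κ}, S ⊆ L → T ⊆ L → S.card < d → T.card ≤ d →
      knapsackMoment L.card a (S ∪ T).card =
        (a - S.card)⁻¹ * ∑ j ∈ L \ S, knapsackMoment L.card a (insert j S ∪ T).card := by
    intro S T hSL hTL hS hT
    have hlt : (S ∪ T).card < L.card := (Finset.card_union_le S T).trans_lt (by omega)
    have hne : a - S.card ≠ 0 := by
      have : (S.card : ℚ) + 1 ≤ d := by exact_mod_cast hS
      have h0 : (0 : ℚ) ≤ S.card := by positivity
      push_cast at ha
      linarith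
    simp only [Finset.insert_union]
    rw [sum_knapsackMoment_insert Finset.subset_union_left (Finset.union_subset hSL hTL) hlt,
      inv_mul_cancel_left₀ hne]
  induction k generalizing S T l with
  | zero =>
    induction l generalizing T with
    | zero => exact knapsackMoment_union_of_card_eq hd ha hS hT
    | succ l ih =>
      rw [Finset.union_comm, step hTL hSL (by omega) (by omega)]
      simp only [gramVector_succ L a l, Finset.mul_sum]
      rw [Finset.sum_comm]
      refine Finset.sum_congr rfl fun j hj => ?_
      have hj' := Finset.mem_sdiff.1 hj
      rw [Finset.union_comm, ih (Finset.insert_subset hj'.1 hTL)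
        (by rw [Finset.card_insert_of_notMem hj'.2]; omega), Finset.mul_sum]
      refine Finset.sum_congr rfl fun A _ => ?_
      ring
  | succ k ih =>
    rw [step hSL hTL (by omega) (by omega)]
    simp only [gramVector_succ L a k, Finset.mul_sum, Finset.sum_mul]
    rw [Finset.sum_comm]
    refine Finset.sum_congr rfl fun j hj => ?_
    have hj' := Finset.mem_sdiff.1 hj
    rw [ih (Finset.insert_subset hj'.1 hSL) hTL
      (by rw [Finset.card_insert_of_notMem hj'.2]; omega) hT, Finset.mul_sum]
    refine Finset.sum_congr rfl fun A _ => ?_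
    ring

/-- The matrix of the knapsack moments of low degree is a nonnegative combination of squares. -/
theorem exists_gram_knapsackMoment (L : Finset κ) {a : ℚ} {d : ℕ}
    (hd : 2 * d ≤ L.card) (ha : 0 < a - (2 * d : ℕ) + 1) (hb : 0 ≤ (L.card : ℚ) - a - d) :
    ∃ (c : Finset κ → ℚ) (g : Finset κ → Finset κ → ℚ), (∀ A, 0 ≤ c A) ∧
      ∀ S T : Finset κ, S ⊆ L → T ⊆ L → S.card ≤ d → T.card ≤ d →
        knapsackMoment L.card a (S ∪ T).card = ∑ A, c A * g S A * g T A :=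
  ⟨fun A => gramWeight L.card a d A.card, fun S => gramVector L a (d - S.card) S,
    fun A => gramWeight_nonneg hd ha hb A.card, fun _ _ hS hT hSd hTd =>
      knapsackMoment_union hd ha hS hT (by omega) (by omega)⟩

end Row
/-! ### The pseudo-expectation -/

section PseudoExp

open MvPolynomial

variable {ι κ : Type} [Fintype κ]

/-- The columns `j` such that the variable `(i, j)` occurs in the monomial `μ`. -/
def rowSupport (μ : ι × κ →₀ ℕ) (i : ι) : Finset κ := Finset.univ.filter fun j => μ (i, j) ≠ 0

theorem mem_rowSupport {μ : ι × κ →₀ ℕ} {i : ι} {j : κ} :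
    j ∈ rowSupport μ i ↔ μ (i, j) ≠ 0 := by
  simp [rowSupport]

/-- The polynomials in the variables `(i, j)`, `j ∈ L i`, whose monomials contain at most `d`
different variables from every row. -/
noncomputable def lowDegree (L : ι → Finset κ) (d : ℕ) : Submodule ℚ (MvPolynomial (ι × κ) ℚ) :=
  restrictSupport ℚ {μ | ∀ i, rowSupport μ i ⊆ L i ∧ (rowSupport μ i).card ≤ d}

theorem lowDegree_mono (L : ι → Finset κ) {d e : ℕ} (h : d ≤ e) : lowDegree L d ≤ lowDegree L e :=
  restrictSupport_mono ℚ fun _ hμ i => ⟨(hμ i).1, (hμ i).2.trans h⟩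

theorem lowDegree_induction {L : ι → Finset κ} {d : ℕ} {P : MvPolynomial (ι × κ) ℚ → Prop}
    (h0 : P 0) (hadd : ∀ p q, P p → P q → P (p + q)) (hsmul : ∀ (c : ℚ) p, P p → P (c • p))
    (hmon : ∀ μ, (∀ i, rowSupport μ i ⊆ L i ∧ (rowSupport μ i).card ≤ d) → P (monomial μ 1))
    {p : MvPolynomial (ι × κ) ℚ} (hp : p ∈ lowDegree L d) : P p := by
  rw [lowDegree, restrictSupport_eq_span] at hp
  induction hp using Submodule.span_induction with
  | mem x h =>
    obtain ⟨μ, hμ, rfl⟩ := h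
    exact hmon μ hμ
  | zero => exact h0
  | add p q _ _ hp hq => exact hadd p q hp hq
  | smul c p _ hp => exact hsmul c p hp

section DecidableEq

variable [DecidableEq κ]

theorem rowSupport_add (μ ν : ι × κ →₀ ℕ) (i : ι) :
    rowSupport (μ + ν) i = rowSupport μ i ∪ rowSupport ν i := by
  ext j
  rw [Finset.mem_union, mem_rowSupport, mem_rowSupport, mem_rowSupport, Finsupp.add_apply]
  omega

variable [DecidableEq ι]

theorem rowSupport_single (i i' : ι) (j : κ) {k : ℕ} (hk : k ≠ 0) :
    rowSupport (Finsupp.single (i, j) k) i' = if i' = i then {j} else ∅ := by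
  ext j'
  by_cases h : i' = i
  · subst h
    simp [rowSupport, Finsupp.single_apply, hk, eq_comm]
  · simp [rowSupport, h]

theorem mul_X_mem_lowDegree {L : ι → Finset κ} {d : ℕ} {p : MvPolynomial (ι × κ) ℚ}
    (hp : p ∈ lowDegree L d) {i : ι} {j : κ} (hj : j ∈ L i) :
    p * X (i, j) ∈ lowDegree L (d + 1) := by
  refine lowDegree_induction (P := fun p => p * X (i, j) ∈ lowDegree L (d + 1)) (by simp)
    (fun p q hp hq => ?_) (fun c p hp => ?_) (fun μ hμ => ?_) hp
  · rw [add_mul]; exact add_mem hp hq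
  · rw [smul_mul_assoc]; exact Submodule.smul_mem _ c hp
  · rw [X, monomial_mul, one_mul, lowDegree, monomial_mem_restrictSupport]
    refine Or.inl fun i' => ?_
    rw [rowSupport_add, rowSupport_single _ _ _ one_ne_zero]
    split_ifs with h
    · subst h
      exact ⟨Finset.union_subset (hμ _).1 (by simpa using hj),
        (Finset.card_union_le _ _).trans (by simpa using (hμ _).2)⟩
    · rw [Finset.union_empty]
      exact ⟨(hμ i').1, (hμ i').2.trans (Nat.le_succ d)⟩

end DecidableEq

variable [Fintype ι]

/-- The product over the rows of the functionals given by the knapsack moments. -/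
noncomputable def pseudoExp (L : ι → Finset κ) (a : ι → ℚ) : MvPolynomial (ι × κ) ℚ →ₗ[ℚ] ℚ :=
  (basisMonomials (ι × κ) ℚ).constr ℚ fun μ =>
    ∏ i, knapsackMoment (L i).card (a i) (rowSupport μ i).card

theorem pseudoExp_monomial (L : ι → Finset κ) (a : ι → ℚ) (μ : ι × κ →₀ ℕ) :
    pseudoExp L a (monomial μ 1) = ∏ i, knapsackMoment (L i).card (a i) (rowSupport μ i).card := by
  have := (basisMonomials (ι × κ) ℚ).constr_basis ℚ
    (fun μ => ∏ i, knapsackMoment (L i).card (a i) (rowSupport μ i).card) μ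
  rwa [coe_basisMonomials] at this

theorem pseudoExp_one (L : ι → Finset κ) (a : ι → ℚ) : pseudoExp L a 1 = 1 := by
  rw [← C_1, ← monomial_zero', pseudoExp_monomial]
  simp [rowSupport, knapsackMoment]

variable [DecidableEq ι] [DecidableEq κ]

theorem pseudoExp_mul_X_sq_sub_X (L : ι → Finset κ) (a : ι → ℚ) (p : MvPolynomial (ι × κ) ℚ)
    (ij : ι × κ) : pseudoExp L a (p * (X ij ^ 2 - X ij)) = 0 := by
  induction p using MvPolynomial.induction_on' with
  | monomial μ c =>
    have h : ∀ k : ℕ, k ≠ 0 → pseudoExp L a (monomial μ c * X ij ^ k) =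
        c * ∏ i, knapsackMoment (L i).card (a i)
          (rowSupport μ i ∪ if i = ij.1 then {ij.2} else ∅).card := by
      intro k hk
      have h1 : monomial μ c * X ij ^ k = c • monomial (μ + Finsupp.single (ij.1, ij.2) k) 1 := by
        rw [X_pow_eq_monomial, monomial_mul, smul_monomial, mul_one, smul_eq_mul, mul_one]
      rw [h1, map_smul, pseudoExp_monomial, smul_eq_mul]
      simp only [rowSupport_add, rowSupport_single _ _ _ hk]
    have h1 := h 1 one_ne_zero
    rw [pow_one] at h1
    rw [mul_sub, map_sub, h 2 two_ne_zero, h1, sub_self]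
  | add p q hp hq => rw [add_mul, map_add, hp, hq, add_zero]

theorem pseudoExp_mul_sum_X {L : ι → Finset κ} (a : ι → ℚ) {d : ℕ} {i : ι}
    (hd : d < (L i).card) {p : MvPolynomial (ι × κ) ℚ} (hp : p ∈ lowDegree L d) :
    pseudoExp L a (p * ∑ j ∈ L i, X (i, j)) = a i * pseudoExp L a p := by
  refine lowDegree_induction
    (P := fun p => pseudoExp L a (p * ∑ j ∈ L i, X (i, j)) = a i * pseudoExp L a p) (by simp)
    (fun p q hp hq => ?_) (fun c p hp => ?_) (fun μ hμ => ?_) hp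
  · rw [add_mul, map_add, map_add, hp, hq, mul_add]
  · rw [smul_mul_assoc, map_smul, map_smul, hp, smul_eq_mul, smul_eq_mul]
    ring
  · have h1 := sum_knapsackMoment_insert (a := a i) (Finset.empty_subset (rowSupport μ i))
      (hμ i).1 ((hμ i).2.trans_lt hd)
    rw [Finset.sdiff_empty, Finset.card_empty, Nat.cast_zero, sub_zero] at h1
    have h2 : ∀ j, pseudoExp L a (monomial μ 1 * X (i, j)) =
        knapsackMoment (L i).card (a i) (insert j (rowSupport μ i)).card *
          ∏ i' ∈ Finset.univ.erase i,
            knapsackMoment (L i').card (a i') (rowSupport μ i').card := by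
      intro j
      rw [X, monomial_mul, one_mul, pseudoExp_monomial,
        ← Finset.mul_prod_erase _ _ (Finset.mem_univ i)]
      congr 1
      · rw [rowSupport_add, rowSupport_single _ _ _ one_ne_zero, if_pos rfl, Finset.union_comm]
        rfl
      · refine Finset.prod_congr rfl fun i' hi' => ?_
        rw [rowSupport_add, rowSupport_single _ _ _ one_ne_zero,
          if_neg (Finset.ne_of_mem_erase hi'), Finset.union_empty]
    rw [Finset.mul_sum, map_sum, Finset.sum_congr rfl fun j _ => h2 j, ← Finset.sum_mul, h1,
      pseudoExp_monomial, ← Finset.mul_prod_erase _ _ (Finset.mem_univ i), mul_assoc]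

/-- The Gram vectors of the rows are tensored: a product over rows of sums of weighted products
expands into one such sum indexed by families of sets, with nonnegative weights. -/
theorem exists_gram_pseudoExp (L : ι → Finset κ) {a : ι → ℚ} {d : ℕ}
    (hd : ∀ i, 2 * d ≤ (L i).card) (ha : ∀ i, 0 < a i - (2 * d : ℕ) + 1)
    (hb : ∀ i, 0 ≤ ((L i).card : ℚ) - a i - d) :
    ∃ (c : (ι → Finset κ) → ℚ) (G : (ι → Finset κ) → MvPolynomial (ι × κ) ℚ →ₗ[ℚ] ℚ),
      (∀ A, 0 ≤ c A) ∧ ∀ p ∈ lowDegree L d, ∀ q ∈ lowDegree L d,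
        pseudoExp L a (p * q) = ∑ A, c A * G A p * G A q := by
  choose c g hc hg using fun i => exists_gram_knapsackMoment (L i) (hd i) (ha i) (hb i)
  let G : (ι → Finset κ) → MvPolynomial (ι × κ) ℚ →ₗ[ℚ] ℚ := fun A =>
    (basisMonomials (ι × κ) ℚ).constr ℚ fun μ => ∏ i, g i (rowSupport μ i) (A i)
  have hG : ∀ A μ, G A (monomial μ 1) = ∏ i, g i (rowSupport μ i) (A i) := by
    intro A μ
    have := (basisMonomials (ι × κ) ℚ).constr_basis ℚ
      (fun μ => ∏ i, g i (rowSupport μ i) (A i)) μ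
    rwa [coe_basisMonomials] at this
  refine ⟨fun A => ∏ i, c i (A i), G, fun A => Finset.prod_nonneg fun i _ => hc i _,
    fun p hp q hq => ?_⟩
  revert q
  refine lowDegree_induction (P := fun p => ∀ q ∈ lowDegree L d, pseudoExp L a (p * q) =
    ∑ A, (∏ i, c i (A i)) * G A p * G A q) (by simp) (fun p p' hp hp' q hq => ?_)
    (fun r p hp q hq => ?_) (fun μ hμ q hq => ?_) hp
  · rw [add_mul, map_add, hp q hq, hp' q hq, ← Finset.sum_add_distrib]
    refine Finset.sum_congr rfl fun A _ => ?_
    rw [map_add]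
    ring
  · rw [smul_mul_assoc, map_smul, hp q hq, Finset.smul_sum]
    refine Finset.sum_congr rfl fun A _ => ?_
    rw [map_smul, smul_eq_mul, smul_eq_mul]
    ring
  refine lowDegree_induction (P := fun q => pseudoExp L a (monomial μ 1 * q) =
    ∑ A, (∏ i, c i (A i)) * G A (monomial μ 1) * G A q) (by simp) (fun q q' hq hq' => ?_)
    (fun r q hq => ?_) (fun ν hν => ?_) hq
  · rw [mul_add, map_add, hq, hq', ← Finset.sum_add_distrib]
    refine Finset.sum_congr rfl fun A _ => ?_
    rw [map_add]
    ring
  · rw [mul_smul_comm, map_smul, hq, Finset.smul_sum]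
    refine Finset.sum_congr rfl fun A _ => ?_
    rw [map_smul, smul_eq_mul, smul_eq_mul]
    ring
  · rw [monomial_mul, one_mul, pseudoExp_monomial]
    simp only [hG, rowSupport_add, ← Finset.prod_mul_distrib]
    rw [Finset.prod_congr rfl fun i _ =>
      hg i _ _ (hμ i).1 (hν i).1 (hμ i).2 (hν i).2, Finset.prod_univ_sum, Fintype.piFinset_univ]

theorem pseudoExp_sq_nonneg {L : ι → Finset κ} {a : ι → ℚ} {d : ℕ}
    (hd : ∀ i, 2 * d ≤ (L i).card) (ha : ∀ i, 0 < a i - (2 * d : ℕ) + 1)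
    (hb : ∀ i, 0 ≤ ((L i).card : ℚ) - a i - d) {p : MvPolynomial (ι × κ) ℚ}
    (hp : p ∈ lowDegree L d) : 0 ≤ pseudoExp L a (p ^ 2) := by
  obtain ⟨c, G, hc, hG⟩ := exists_gram_pseudoExp L hd ha hb
  rw [sq, hG p hp p hp]
  refine Finset.sum_nonneg fun A _ => ?_
  rw [mul_assoc]
  exact mul_nonneg (hc A) (mul_self_nonneg _)

end PseudoExp
/-! ### Restrictions -/

section Restriction

open MvPolynomial

/-- The value of the variable `x_a` under the restriction `ρ`. -/
noncomputable def restrictVar {σ : Type} (ρ : σ → Option Bool) (a : σ) : MvPolynomial σ ℚ :=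
  match ρ a with
  | none => X a
  | some true => 1
  | some false => 0

/-- Substitute the values of a restriction, and `1 - x_a` for the twin variable of `x_a`. -/
noncomputable def restrict {σ : Type} (ρ : σ → Option Bool) : Poly σ →ₐ[ℚ] MvPolynomial σ ℚ :=
  aeval (Sum.elim (restrictVar ρ) fun a => 1 - restrictVar ρ a)

variable {σ : Type} (ρ : σ → Option Bool)

theorem restrict_x (a : σ) : restrict ρ (x a) = restrictVar ρ a := by
  simp [restrict, x]

theorem restrict_xbar (a : σ) : restrict ρ (xbar a) = 1 - restrictVar ρ a := by
  simp [restrict, xbar]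

theorem restrict_monomial (μ : Monom σ) :
    restrict ρ (monomial μ 1) =
      μ.prod fun b k => Sum.elim (restrictVar ρ) (fun a => 1 - restrictVar ρ a) b ^ k := by
  rw [restrict, aeval_monomial, map_one, one_mul]

theorem restrict_eq_sum (p : Poly σ) :
    restrict ρ p = ∑ μ ∈ p.support, p.coeff μ • restrict ρ (monomial μ 1) := by
  conv_lhs => rw [p.as_sum]
  rw [map_sum]
  refine Finset.sum_congr rfl fun μ _ => ?_
  rw [← map_smul, smul_monomial, smul_eq_mul, mul_one]

theorem restrict_monomial_eq_zero_of_inl {μ : Monom σ} {a : σ} (hμ : μ (Sum.inl a) ≠ 0)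
    (ha : ρ a = some false) : restrict ρ (monomial μ 1) = 0 := by
  rw [restrict_monomial]
  refine Finset.prod_eq_zero (Finsupp.mem_support_iff.2 hμ) ?_
  simp [restrictVar, ha, hμ]

theorem restrict_monomial_eq_zero_of_inr {μ : Monom σ} {a : σ} (hμ : μ (Sum.inr a) ≠ 0)
    (ha : ρ a = some true) : restrict ρ (monomial μ 1) = 0 := by
  rw [restrict_monomial]
  refine Finset.prod_eq_zero (Finsupp.mem_support_iff.2 hμ) ?_
  simp [restrictVar, ha, hμ]

/-- The unset variables that occur in a monomial, either themselves or as twins. -/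
def unsetVars (μ : Monom σ) : Set σ :=
  {a | ρ a = none ∧ (μ (Sum.inl a) ≠ 0 ∨ μ (Sum.inr a) ≠ 0)}

theorem restrict_monomial_mem_supported (μ : Monom σ) :
    restrict ρ (monomial μ 1) ∈ supported ℚ (unsetVars ρ μ) := by
  have key : ∀ a, (μ (Sum.inl a) ≠ 0 ∨ μ (Sum.inr a) ≠ 0) →
      restrictVar ρ a ∈ supported ℚ (unsetVars ρ μ) := by
    intro a ha
    rw [restrictVar]
    split
    · exact X_mem_supported.2 ⟨by assumption, ha⟩
    · exact one_mem _
    · exact zero_mem _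
  rw [restrict_monomial]
  refine Subalgebra.prod_mem _ fun b hb => Subalgebra.pow_mem _ ?_ _
  have hb' := Finsupp.mem_support_iff.1 hb
  rcases b with a | a
  · exact key a (Or.inl hb')
  · exact sub_mem (one_mem _) (key a (Or.inr hb'))

/-- The ideal of the Boolean axioms. -/
noncomputable def booleanIdeal (σ : Type) : Ideal (MvPolynomial σ ℚ) :=
  Ideal.span (Set.range fun a => X a ^ 2 - X a)

theorem restrictVar_sq_sub_mem (a : σ) :
    restrictVar ρ a ^ 2 - restrictVar ρ a ∈ booleanIdeal σ := by
  rw [restrictVar]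
  split
  · exact Ideal.subset_span ⟨a, rfl⟩
  · simp
  · simp

/-- In the quotient by the Boolean axioms, every x and every 1 - x is idempotent, and products of
commuting idempotents are idempotent. -/
theorem restrict_monomial_sq_sub_mem (μ : Monom σ) :
    restrict ρ (monomial μ 1) ^ 2 - restrict ρ (monomial μ 1) ∈ booleanIdeal σ := by
  have toIdem : ∀ p : MvPolynomial σ ℚ, p ^ 2 - p ∈ booleanIdeal σ ↔
      IsIdempotentElem (Ideal.Quotient.mk (booleanIdeal σ) p) := by
    intro p
    rw [IsIdempotentElem, ← map_mul, Ideal.Quotient.eq, sq]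
  rw [toIdem, restrict_monomial, Finsupp.prod, map_prod]
  refine Finset.prod_induction _ IsIdempotentElem (fun _ _ h h' => h.mul h') IsIdempotentElem.one
    fun b _ => ?_
  rw [map_pow]
  refine IsIdempotentElem.pow _ ((toIdem _).1 ?_)
  rcases b with a | a
  · exact restrictVar_sq_sub_mem ρ a
  · have : (1 - restrictVar ρ a) ^ 2 - (1 - restrictVar ρ a) =
        restrictVar ρ a ^ 2 - restrictVar ρ a := by ring
    simpa only [Sum.elim_inr, this] using restrictVar_sq_sub_mem ρ a

end Restriction

/-! ### The pseudo-expectation of restricted polynomials. -/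

section RestrictedPseudoExp

open MvPolynomial

variable {ι κ : Type} [Fintype κ]

/-- The columns of the variables of the row `i` left unset by the restriction `ρ`. -/
def unsetRow (ρ : ι × κ → Option Bool) (i : ι) : Finset κ :=
  Finset.univ.filter fun j => ρ (i, j) = none

theorem restrict_monomial_mem_lowDegree (ρ : ι × κ → Option Bool) {μ : Monom (ι × κ)} {d : ℕ}
    (hμ : ∀ i, (Finset.univ.filter fun j =>
      μ (Sum.inl (i, j)) ≠ 0 ∨ μ (Sum.inr (i, j)) ≠ 0).card ≤ d) :
    restrict ρ (monomial μ 1) ∈ lowDegree (unsetRow ρ) d := by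
  rw [lowDegree, mem_restrictSupport_iff]
  intro ν hν i
  have hvars := mem_supported.1 (restrict_monomial_mem_supported ρ μ)
  have key : ∀ j ∈ rowSupport ν i, (i, j) ∈ unsetVars ρ μ := fun j hj =>
    hvars ((mem_vars_iff_mem_support _).2 ⟨ν, hν, Finsupp.mem_support_iff.2 (mem_rowSupport.1 hj)⟩)
  refine ⟨fun j hj => ?_, (Finset.card_le_card fun j hj => ?_).trans (hμ i)⟩
  · simpa [unsetRow] using (key j hj).1
  · simpa using (key j hj).2

variable [Fintype ι] [DecidableEq ι] [DecidableEq κ]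

theorem pseudoExp_eq_zero_of_mem (L : ι → Finset κ) (a : ι → ℚ) {p : MvPolynomial (ι × κ) ℚ}
    (hp : p ∈ booleanIdeal (ι × κ)) : pseudoExp L a p = 0 := by
  -- Vanishing is proved for all multiples `q * p`, so that the induction passes through scalar
  -- multiplication; `q = 1` gives the claim.
  refine Submodule.span_induction (p := fun p _ => ∀ q, pseudoExp L a (q * p) = 0) ?_ (by simp)
    (fun p p' _ _ hp hp' q => ?_) (fun r p _ hp q => ?_) hp 1 |>.symm ▸ (by rw [one_mul])
  · rintro _ ⟨ij, rfl⟩ q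
    exact pseudoExp_mul_X_sq_sub_X L a q ij
  · rw [mul_add, map_add, hp, hp', add_zero]
  · rw [smul_eq_mul, ← mul_assoc, hp]

theorem pseudoExp_restrict_logical (L : ι → Finset κ) (a : ι → ℚ) (ρ : ι × κ → Option Bool)
    (ij : ι × κ) (u v : Poly (ι × κ)) :
    pseudoExp L a (restrict ρ (u * (x ij ^ 2 - x ij) + v * (x ij + xbar ij - 1))) = 0 := by
  simp only [map_add, map_sub, map_mul, map_pow, map_one, restrict_x, restrict_xbar]
  rw [add_sub_cancel, sub_self, mul_zero, map_zero, add_zero]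
  exact pseudoExp_eq_zero_of_mem L a (Ideal.mul_mem_left _ _ (restrictVar_sq_sub_mem ρ ij))

theorem abs_pseudoExp_restrict_le {ρ : ι × κ → Option Bool} {a : ι → ℚ} {d : ℕ}
    (hd : ∀ i, 2 * d ≤ (unsetRow ρ i).card) (ha : ∀ i, 0 < a i - (2 * d : ℕ) + 1)
    (hb : ∀ i, 0 ≤ ((unsetRow ρ i).card : ℚ) - a i - d) {p : Poly (ι × κ)}
    (hp : ∀ μ ∈ p.support, restrict ρ (monomial μ 1) ∈ lowDegree (unsetRow ρ) d) :
    |pseudoExp (unsetRow ρ) a (restrict ρ p)| ≤ ∑ μ ∈ p.support, |p.coeff μ| := by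
  rw [restrict_eq_sum, map_sum]
  refine (Finset.abs_sum_le_sum_abs _ _).trans (Finset.sum_le_sum fun μ hμ => ?_)
  rw [map_smul, smul_eq_mul, abs_mul]
  refine mul_le_of_le_one_right (abs_nonneg _) ?_
  set f := restrict ρ (monomial μ 1) with hf
  have h1 : pseudoExp (unsetRow ρ) a (f ^ 2) = pseudoExp (unsetRow ρ) a f := by
    rw [← sub_eq_zero, ← map_sub]
    exact pseudoExp_eq_zero_of_mem _ _ (restrict_monomial_sq_sub_mem ρ μ)
  have hone : (1 : MvPolynomial (ι × κ) ℚ) ∈ lowDegree (unsetRow ρ) d := by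
    rw [← C_1, ← monomial_zero', lowDegree, monomial_mem_restrictSupport]
    exact Or.inl fun i => by simp [rowSupport]
  have h2 := pseudoExp_sq_nonneg hd ha hb (hp μ hμ)
  have h3 := pseudoExp_sq_nonneg hd ha hb (sub_mem hone (hp μ hμ))
  rw [← hf] at h2 h3
  -- With E f² = E f, nonnegativity on f² and on (1 - f)² reads 0 ≤ E f ≤ 1.
  rw [show (1 - f) ^ 2 = 1 - 2 • f + f ^ 2 by rw [two_smul]; ring, map_add, map_sub, map_nsmul,
    pseudoExp_one, two_smul] at h3
  rw [abs_le]
  constructor <;> linarith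

end RestrictedPseudoExp
/-! ### Large coefficients -/

section LargeCoefficients

open MvPolynomial

/-- The value of `ks_i` that the constraints of `Q_n` enforce. -/
def ksValue (i : ℕ) : ℚ := (1 / 2) ^ 2 ^ i

theorem ksValue_pos (i : ℕ) : 0 < ksValue i := by
  unfold ksValue
  positivity

theorem ksValue_le (i : ℕ) : ksValue i ≤ 1 / 2 := by
  unfold ksValue
  exact pow_le_of_le_one (by norm_num) (by norm_num) (by positivity)

theorem ksValue_sq (i : ℕ) : ksValue i ^ 2 = ksValue (i + 1) := by
  rw [ksValue, ksValue, ← pow_mul, pow_succ]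

variable {n m : ℕ} {ρ : Idx n → Option Bool}

/-- The pseudo-expectation that gives `ks_i` the value `ksValue i`. -/
noncomputable def ksExp (m : ℕ) (ρ : Idx n → Option Bool) : MvPolynomial (Idx n) ℚ →ₗ[ℚ] ℚ :=
  pseudoExp (unsetRow ρ) fun i => m + ksValue i

/-- A balanced restriction preserves the shape of the knapsack, with `m` in place of `n`; hence the
target sum `m + ksValue i` in `ksExp`. -/
theorem restrict_ks {i : Fin n}
    (hone : (Finset.univ.filter fun j => ρ (i, j) = some true).card + m = n) :
    restrict ρ (ks i) = ∑ j ∈ unsetRow ρ i, X (i, j) - C (m : ℚ) := by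
  have h1 : ∀ j, restrictVar ρ (i, j) = (if ρ (i, j) = none then X (i, j) else 0) +
      (if ρ (i, j) = some true then 1 else 0) := by
    intro j
    rw [restrictVar]
    rcases ρ (i, j) with _ | _ | _ <;> simp
  have h2 : (n : MvPolynomial (Idx n) ℚ) =
      (Finset.univ.filter fun j => ρ (i, j) = some true).card + m := by
    exact_mod_cast hone.symm
  rw [ks, map_sub, map_sum]
  simp only [restrict_x, h1]
  rw [Finset.sum_add_distrib, ← Finset.sum_filter, ← Finset.sum_filter, Finset.sum_const,
    nsmul_one, ← unsetRow]
  simp only [map_natCast]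
  rw [h2]
  ring

theorem mul_restrict_ks_mem_lowDegree {i : Fin n} {d : ℕ}
    (hone : (Finset.univ.filter fun j => ρ (i, j) = some true).card + m = n)
    {p : MvPolynomial (Idx n) ℚ} (hp : p ∈ lowDegree (unsetRow ρ) d) :
    p * restrict ρ (ks i) ∈ lowDegree (unsetRow ρ) (d + 1) := by
  rw [restrict_ks hone, mul_sub, Finset.mul_sum, mul_comm p (C _), ← smul_eq_C_mul]
  exact sub_mem (sum_mem fun j hj => mul_X_mem_lowDegree hp hj)
    (Submodule.smul_mem _ _ (lowDegree_mono _ (Nat.le_succ d) hp))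

theorem ksExp_mul_ks {i : Fin n} {d : ℕ} (hcard : (unsetRow ρ i).card = 2 * m)
    (hone : (Finset.univ.filter fun j => ρ (i, j) = some true).card + m = n) (hd : d < 2 * m)
    {p : MvPolynomial (Idx n) ℚ} (hp : p ∈ lowDegree (unsetRow ρ) d) :
    ksExp m ρ (p * restrict ρ (ks i)) = ksValue i * ksExp m ρ p := by
  rw [restrict_ks hone, mul_sub, map_sub, ksExp, pseudoExp_mul_sum_X _ (hcard ▸ hd) hp,
    mul_comm p (C _), ← smul_eq_C_mul, map_smul, smul_eq_mul]
  ring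

theorem ksExp_mul_ks_sq {i : Fin n} {d : ℕ} (hcard : (unsetRow ρ i).card = 2 * m)
    (hone : (Finset.univ.filter fun j => ρ (i, j) = some true).card + m = n) (hd : d + 1 < 2 * m)
    {p : MvPolynomial (Idx n) ℚ} (hp : p ∈ lowDegree (unsetRow ρ) d) :
    ksExp m ρ (p * restrict ρ (ks i) ^ 2) = ksValue (i + 1) * ksExp m ρ p := by
  rw [sq, ← mul_assoc, ksExp_mul_ks hcard hone hd (mul_restrict_ks_mem_lowDegree hone hp),
    ksExp_mul_ks hcard hone (by omega) hp, ← ksValue_sq]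
  ring

/-- Only the constraint on the square of the last `ks` is violated, and there E scales by exactly
`ksValue n`. Up to two factors `ks` are multiplied in, hence the margin `d + 1 < 2 * m`. -/
theorem abs_ksExp_mul_constraint_le {d : ℕ} (hcard : ∀ i, (unsetRow ρ i).card = 2 * m)
    (hone : ∀ i, (Finset.univ.filter fun j => ρ (i, j) = some true).card + m = n)
    (hd : d + 1 < 2 * m) {p : MvPolynomial (Idx n) ℚ} (hp : p ∈ lowDegree (unsetRow ρ) d)
    {q : Poly (Idx n)} (hq : q ∈ Q n) :
    |ksExp m ρ (p * restrict ρ q)| ≤ ksValue n * |ksExp m ρ p| := by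
  have hnonneg : 0 ≤ ksValue n * |ksExp m ρ p| := mul_nonneg (ksValue_pos n).le (abs_nonneg _)
  simp only [Q, Finset.mem_union, Finset.mem_image, Finset.mem_filter, Finset.mem_univ,
    true_and] at hq
  rcases hq with (⟨i, hi, rfl⟩ | ⟨⟨i, j⟩, hij, rfl⟩) | ⟨i, hi, rfl⟩
  · have hC : restrict ρ (C (1 / 2 : ℚ)) = C (1 / 2) := (restrict ρ).commutes _
    rw [map_sub, mul_sub, map_sub, ksExp_mul_ks (hcard i) (hone i) (by omega) hp, hi, hC,
      mul_comm p (C _), ← smul_eq_C_mul, map_smul, ksValue, pow_zero, pow_one, smul_eq_mul,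
      sub_self, abs_zero]
    exact hnonneg
  · simp only at hij ⊢
    rw [map_sub, map_pow, mul_sub, map_sub, ksExp_mul_ks_sq (hcard i) (hone i) hd hp,
      ksExp_mul_ks (hcard j) (hone j) (by omega) hp, hij, sub_self, abs_zero]
    exact hnonneg
  · rw [map_pow, ksExp_mul_ks_sq (hcard i) (hone i) hd hp, hi, abs_mul,
      abs_of_pos (ksValue_pos n)]

/-- If a restriction leaves only monomials of low degree in a refutation of `Q_n`, then some of the
lifts of the refutation have large coefficients. -/
theorem two_pow_le_sum_abs_coeff {d : ℕ} (π : SOSRefutation (Q n))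
    (hcard : ∀ i, (unsetRow ρ i).card = 2 * m)
    (hone : ∀ i, (Finset.univ.filter fun j => ρ (i, j) = some true).card + m = n)
    (hd : 1 ≤ d) (hdm : 2 * d ≤ m)
    (hr : ∀ p ∈ π.r, ∀ μ ∈ p.support,
      restrict ρ (monomial μ 1) ∈ lowDegree (unsetRow ρ) d)
    (ht : ∀ q, ∀ μ ∈ (π.t q).support,
      restrict ρ (monomial μ 1) ∈ lowDegree (unsetRow ρ) d) :
    (2 : ℚ) ^ 2 ^ n ≤ ∑ q, ∑ μ ∈ (π.t q).support, |(π.t q).coeff μ| := by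
  have hdm' : (2 * d : ℚ) ≤ m := by exact_mod_cast hdm
  have hd' : (1 : ℚ) ≤ d := by exact_mod_cast hd
  have h1 : ∀ i, 2 * d ≤ (unsetRow ρ i).card := fun i => by rw [hcard]; omega
  have h2 : ∀ i : Fin n, (0 : ℚ) < m + ksValue i - (2 * d : ℕ) + 1 := fun i => by
    have := ksValue_pos i
    push_cast
    linarith
  -- Here m - d ≥ d ≥ 1 absorbs the fractional value, which is at most 1/2.
  have h3 : ∀ i : Fin n, (0 : ℚ) ≤ ((unsetRow ρ i).card : ℚ) - (m + ksValue i) - d := fun i => by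
    have := ksValue_le i
    rw [hcard]
    push_cast
    linarith
  have hmem : ∀ p : Poly (Idx n),
      (∀ μ ∈ p.support, restrict ρ (monomial μ 1) ∈ lowDegree (unsetRow ρ) d) →
      restrict ρ p ∈ lowDegree (unsetRow ρ) d := fun p hp => by
    rw [restrict_eq_sum]
    exact sum_mem fun μ hμ => Submodule.smul_mem _ _ (hp μ hμ)
  have hE := congrArg (fun p => ksExp m ρ (restrict ρ p)) π.identity
  simp only [map_add (restrict ρ), map_add (ksExp m ρ)] at hE
  have hleft : ksExp m ρ (restrict ρ (-1)) = -1 := by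
    rw [map_neg, map_one, map_neg, ksExp, pseudoExp_one]
  have hsq : 0 ≤ ksExp m ρ (restrict ρ (π.r.map fun p => p ^ 2).sum) := by
    rw [map_list_sum, map_list_sum, List.map_map, List.map_map]
    refine List.sum_nonneg fun c hc => ?_
    obtain ⟨p, hp, rfl⟩ := List.mem_map.1 hc
    simp only [Function.comp_apply, map_pow]
    exact pseudoExp_sq_nonneg h1 h2 h3 (hmem p (hr p hp))
  have hlog : ksExp m ρ (restrict ρ
      (∑ a, (π.u a * (x a ^ 2 - x a) + π.v a * (x a + xbar a - 1)))) = 0 := by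
    rw [map_sum, map_sum]
    exact Finset.sum_eq_zero fun a _ => pseudoExp_restrict_logical _ _ ρ a _ _
  have hlift : |ksExp m ρ (restrict ρ (∑ q : {q // q ∈ Q n}, π.t q * q.1))| ≤
      ksValue n * ∑ q, ∑ μ ∈ (π.t q).support, |(π.t q).coeff μ| := by
    rw [map_sum, map_sum, Finset.mul_sum]
    refine (Finset.abs_sum_le_sum_abs _ _).trans (Finset.sum_le_sum fun q _ => ?_)
    rw [map_mul]
    refine (abs_ksExp_mul_constraint_le hcard hone (by omega) (hmem _ (ht q)) q.2).trans ?_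
    exact mul_le_mul_of_nonneg_left (abs_pseudoExp_restrict_le h1 h2 h3 (ht q)) (ksValue_pos n).le
  have hfin : 1 ≤ ksValue n * ∑ q, ∑ μ ∈ (π.t q).support, |(π.t q).coeff μ| := by
    have := neg_abs_le (ksExp m ρ (restrict ρ (∑ q : {q // q ∈ Q n}, π.t q * q.1)))
    linarith
  rw [ksValue, one_div, inv_pow, ← div_eq_inv_mul, le_div_iff₀ (by positivity), one_mul] at hfin
  exact hfin

end LargeCoefficients
/-! ### Restrictions that remove the monomials of high degree -/

section BlockRestriction

/-- In a block of four variables, set the variable `o` to `0` and its neighbour to `1`. -/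
def blockPattern (o : Fin 4) (p : ℕ) : Option Bool :=
  if p / 2 = o.val / 2 then some (decide (p ≠ o.val)) else none

/-- The values of the variables of one row, cut into `K` blocks of four variables, the remaining
ones being unset. -/
def rowPattern {K : ℕ} (b : Fin K → Fin 4) (j : ℕ) : Option Bool :=
  if h : j / 4 < K then blockPattern (b ⟨j / 4, h⟩) (j % 4) else none

theorem sum_blockPattern (f : Option Bool → ℕ) (o : Fin 4) :
    ∑ p ∈ Finset.range 4, f (blockPattern o p) =
      f (some true) + f (some false) + 2 * f none := by
  fin_cases o <;> simp [Finset.sum_range_succ, blockPattern] <;> ring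

/-- Taking indicators for `f` counts the ones and the unset variables of a row, independently of
`b`. -/
theorem sum_rowPattern {K : ℕ} (f : Option Bool → ℕ) (b : Fin K → Fin 4) (r : ℕ) :
    ∑ j ∈ Finset.range (4 * K + r), f (rowPattern b j) =
      K * (f (some true) + f (some false) + 2 * f none) + r * f none := by
  have blocks : ∀ k ≤ K, ∑ j ∈ Finset.range (4 * k), f (rowPattern b j) =
      k * (f (some true) + f (some false) + 2 * f none) := by
    intro k hk
    induction k with
    | zero => simp
    | succ k ih =>
      rw [mul_add, Finset.sum_range_add, ih (by omega), mul_one, add_mul, one_mul,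
        ← sum_blockPattern f (b ⟨k, hk⟩)]
      congr 1
      refine Finset.sum_congr rfl fun p hp => ?_
      have hp4 := Finset.mem_range.1 hp
      have e1 : (4 * k + p) / 4 = k := by omega
      have e2 : (4 * k + p) % 4 = p := by omega
      simp only [rowPattern, e1, e2]
      rw [dif_pos (by omega)]
  rw [Finset.sum_range_add, blocks K le_rfl]
  congr 1
  rw [Finset.sum_congr rfl fun p _ => ?_, Finset.sum_const, Finset.card_range, smul_eq_mul]
  rw [rowPattern, dif_neg (by omega)]

variable {n : ℕ}

/-- The restriction that sets half of the variables of every block of four variables. -/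
def blockRestriction (b : Fin n × Fin (n / 2) → Fin 4) (ij : Idx n) : Option Bool :=
  rowPattern (fun q => b (ij.1, q)) ij.2

theorem sum_blockRestriction (f : Option Bool → ℕ) (b : Fin n × Fin (n / 2) → Fin 4) (i : Fin n) :
    ∑ j, f (blockRestriction b (i, j)) =
      n / 2 * (f (some true) + f (some false) + 2 * f none) +
        (2 * n - 4 * (n / 2)) * f none := by
  rw [← sum_rowPattern f (fun q => b (i, q)),
    show 4 * (n / 2) + (2 * n - 4 * (n / 2)) = 2 * n by omega]
  exact Fin.sum_univ_eq_sum_range (fun j => f (rowPattern (fun q => b (i, q)) j)) (2 * n)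

theorem card_unsetRow_blockRestriction (b : Fin n × Fin (n / 2) → Fin 4) (i : Fin n) :
    (unsetRow (blockRestriction b) i).card = 2 * (n - n / 2) := by
  have := sum_blockRestriction (fun v => if v = none then 1 else 0) b i
  rw [unsetRow, Finset.card_filter, this]
  simp
  omega

theorem card_filter_blockRestriction_true (b : Fin n × Fin (n / 2) → Fin 4) (i : Fin n) :
    (Finset.univ.filter fun j => blockRestriction b (i, j) = some true).card +
      (n - n / 2) = n := by
  have := sum_blockRestriction (fun v => if v = some true then 1 else 0) b i
  rw [Finset.card_filter, this]
  simp
  omega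

open Classical in
/-- The blocks in which some variable occurs in `μ`, either itself or as its twin. -/
noncomputable def touchedBlocks (μ : Monom (Idx n)) : Finset (Fin n × Fin (n / 2)) :=
  Finset.univ.filter fun B => ∃ j : Fin (2 * n), j.val / 4 = B.2.val ∧
    (μ (Sum.inl (B.1, j)) ≠ 0 ∨ μ (Sum.inr (B.1, j)) ≠ 0)

theorem exists_blockPattern_eq (p : Fin 4) (v : Bool) : ∃ o, blockPattern o p = some v := by
  revert p v
  decide

theorem exists_restrict_eq_zero {μ : Monom (Idx n)} {B : Fin n × Fin (n / 2)}
    (hB : B ∈ touchedBlocks μ) : ∃ o, ∀ b : Fin n × Fin (n / 2) → Fin 4, b B = o →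
      restrict (blockRestriction b) (MvPolynomial.monomial μ 1) = 0 := by
  obtain ⟨i, q, hq⟩ := B
  simp only [touchedBlocks, Finset.mem_filter, Finset.mem_univ, true_and] at hB
  obtain ⟨j, rfl, hj⟩ := hB
  have key : ∀ v, ∃ o, ∀ b : Fin n × Fin (n / 2) → Fin 4, b (i, ⟨j.val / 4, hq⟩) = o →
      blockRestriction b (i, j) = some v := by
    intro v
    obtain ⟨o, ho⟩ := exists_blockPattern_eq ⟨j.val % 4, Nat.mod_lt _ (by norm_num)⟩ v
    refine ⟨o, fun b hb => ?_⟩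
    simp only [blockRestriction, rowPattern]
    rw [dif_pos hq, hb, ← ho]
  rcases hj with hj | hj
  · obtain ⟨o, ho⟩ := key false
    exact ⟨o, fun b hb => restrict_monomial_eq_zero_of_inl _ hj (ho b hb)⟩
  · obtain ⟨o, ho⟩ := key true
    exact ⟨o, fun b hb => restrict_monomial_eq_zero_of_inr _ hj (ho b hb)⟩

theorem card_row_le (μ : Monom (Idx n)) (i : Fin n) :
    (Finset.univ.filter fun j =>
      μ (Sum.inl (i, j)) ≠ 0 ∨ μ (Sum.inr (i, j)) ≠ 0).card ≤
        4 * ((touchedBlocks μ).card + 1) := by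
  set R := Finset.univ.filter fun j : Fin (2 * n) =>
    μ (Sum.inl (i, j)) ≠ 0 ∨ μ (Sum.inr (i, j)) ≠ 0 with hR
  have h1 : R.card ≤ 4 * (R.image fun j => j.val / 4).card := by
    refine Finset.card_le_mul_card_image R 4 fun q _ => ?_
    refine (Finset.card_le_card_of_injOn (t := Finset.range 4) (fun j => j.val % 4)
      (fun j _ => by simpa using Nat.mod_lt _ (by norm_num)) fun j hj j' hj' h => ?_).trans
      (Finset.card_range 4).le
    have e := (Finset.mem_filter.1 (Finset.mem_coe.1 hj)).2
    have e' := (Finset.mem_filter.1 (Finset.mem_coe.1 hj')).2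
    simp only at h
    exact Fin.ext (by omega)
  -- The leftover variables of a row, when `n` is odd, form an incomplete block with index `n / 2`;
  -- this is the `+ 1` in the bound.
  have h2 : (R.image fun j => j.val / 4) ⊆
      insert (n / 2) ((touchedBlocks μ).image fun B => B.2.val) := by
    intro q hq
    obtain ⟨j, hj, rfl⟩ := Finset.mem_image.1 hq
    rw [Finset.mem_insert]
    by_cases h : j.val / 4 < n / 2
    · refine Or.inr (Finset.mem_image.2 ⟨(i, ⟨j.val / 4, h⟩), ?_, rfl⟩)
      simp only [touchedBlocks, Finset.mem_filter, Finset.mem_univ, true_and]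
      exact ⟨j, rfl, (Finset.mem_filter.1 hj).2⟩
    · have := j.isLt
      exact Or.inl (by omega)
  have h3 := (Finset.card_le_card h2).trans (Finset.card_insert_le _ _)
  have h4 := Finset.card_image_le (s := touchedBlocks μ) (f := fun B => B.2.val)
  omega

end BlockRestriction

/-! ### The union bound over the choices in the blocks. -/

/-- A few partial functions with large domains can all be met by one function into `Fin 4`. -/
theorem exists_forall_exists_eq {α β : Type} [Fintype β] [DecidableEq β] (F : Finset α)
    (B : α → Finset β) (o : α → β → Fin 4) {D : ℕ} (hB : ∀ f ∈ F, D ≤ (B f).card)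
    (hF : F.card * 3 ^ D < 4 ^ D) : ∃ b : β → Fin 4, ∀ f ∈ F, ∃ y ∈ B f, b y = o f y := by
  classical
  by_contra! hcon
  let bad : α → Finset (β → Fin 4) := fun f =>
    Fintype.piFinset fun y => if y ∈ B f then Finset.univ.erase (o f y) else Finset.univ
  have hsub : (Finset.univ : Finset (β → Fin 4)) ⊆ F.biUnion bad := by
    intro b _
    obtain ⟨f, hf, hb⟩ := hcon b
    refine Finset.mem_biUnion.2 ⟨f, hf, Fintype.mem_piFinset.2 fun y => ?_⟩
    split_ifs with hy
    · exact Finset.mem_erase.2 ⟨hb y hy, Finset.mem_univ _⟩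
    · exact Finset.mem_univ _
  -- A function that misses `f` has three values left at each point of `B f`, so a fraction at most
  -- (3/4)^D of all functions is bad for `f`.
  have hbad : ∀ f ∈ F, (bad f).card * 4 ^ D ≤ 3 ^ D * 4 ^ Fintype.card β := by
    intro f hf
    have h1 : (bad f).card = 3 ^ (B f).card * 4 ^ (B f)ᶜ.card := by
      rw [Fintype.card_piFinset, ← Finset.prod_mul_prod_compl (B f)]
      congr 1
      · rw [Finset.prod_congr rfl fun y hy => by rw [if_pos hy], Finset.prod_congr rfl fun y _ =>
          Finset.card_erase_of_mem (Finset.mem_univ (o f y))]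
        simp
      · rw [Finset.prod_congr rfl fun y hy => by rw [if_neg (Finset.mem_compl.1 hy)]]
        simp
    obtain ⟨e, he⟩ := Nat.exists_eq_add_of_le (hB f hf)
    rw [h1, ← Finset.card_add_card_compl (B f), he]
    calc 3 ^ (D + e) * 4 ^ (B f)ᶜ.card * 4 ^ D
        = 3 ^ D * (3 ^ e * 4 ^ (D + (B f)ᶜ.card)) := by ring
      _ ≤ 3 ^ D * (4 ^ e * 4 ^ (D + (B f)ᶜ.card)) := by gcongr; norm_num
      _ = 3 ^ D * 4 ^ (D + e + (B f)ᶜ.card) := by ring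
  have hcard : 4 ^ Fintype.card β ≤ ∑ f ∈ F, (bad f).card := by
    have := (Finset.card_le_card hsub).trans Finset.card_biUnion_le
    simpa using this
  have hle : 4 ^ Fintype.card β * 4 ^ D ≤ F.card * (3 ^ D * 4 ^ Fintype.card β) :=
    calc 4 ^ Fintype.card β * 4 ^ D ≤ (∑ f ∈ F, (bad f).card) * 4 ^ D :=
          Nat.mul_le_mul_right _ hcard
      _ = ∑ f ∈ F, (bad f).card * 4 ^ D := Finset.sum_mul ..
      _ ≤ F.card * (3 ^ D * 4 ^ Fintype.card β) := by
          simpa using Finset.sum_le_card_nsmul F _ _ hbad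
  have hlt : F.card * 3 ^ D * 4 ^ Fintype.card β < 4 ^ D * 4 ^ Fintype.card β :=
    Nat.mul_lt_mul_of_pos_right hF (by positivity)
  rw [mul_assoc, mul_comm (4 ^ D)] at hlt
  omega

/-- Some restriction removes all the monomials of high degree from a small set of monomials. -/
theorem exists_restriction {n D : ℕ} (F : Finset (Monom (Idx n)))
    (hF : F.card * 3 ^ D < 4 ^ D) : ∃ ρ : Idx n → Option Bool,
      (∀ i, (unsetRow ρ i).card = 2 * (n - n / 2)) ∧
      (∀ i, (Finset.univ.filter fun j => ρ (i, j) = some true).card + (n - n / 2) = n) ∧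
      ∀ μ ∈ F, restrict ρ (MvPolynomial.monomial μ 1) ∈ lowDegree (unsetRow ρ) (4 * D) := by
  classical
  have hex : ∀ (μ : Monom (Idx n)) (B : Fin n × Fin (n / 2)), ∃ o, B ∈ touchedBlocks μ →
      ∀ b : Fin n × Fin (n / 2) → Fin 4, b B = o →
        restrict (blockRestriction b) (MvPolynomial.monomial μ 1) = 0 := by
    intro μ B
    by_cases hB : B ∈ touchedBlocks μ
    · obtain ⟨o, ho⟩ := exists_restrict_eq_zero hB
      exact ⟨o, fun _ => ho⟩
    -- An arbitrary value: untouched blocks are never consulted.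
    · exact ⟨0, fun h => absurd h hB⟩
  choose o ho using hex
  obtain ⟨b, hb⟩ := exists_forall_exists_eq (F.filter fun μ => D ≤ (touchedBlocks μ).card)
    touchedBlocks o (fun μ hμ => (Finset.mem_filter.1 hμ).2)
    ((Nat.mul_le_mul_right _ (Finset.card_filter_le _ _)).trans_lt hF)
  refine ⟨blockRestriction b, card_unsetRow_blockRestriction b,
    card_filter_blockRestriction_true b, fun μ hμ => ?_⟩
  by_cases hD : D ≤ (touchedBlocks μ).card
  · obtain ⟨B, hB, hbB⟩ := hb μ (Finset.mem_filter.2 ⟨hμ, hD⟩)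
    rw [ho μ B hB b hbB]
    exact zero_mem _
  · exact restrict_monomial_mem_lowDegree _ fun i => (card_row_le μ i).trans (by omega)

/-! ### Lengths of representations -/

section Length

variable {σ : Type} {code : Monom σ → List Bool}

theorem lt_two_pow_length_natCode (k : ℕ) : k < 2 ^ (natCode k).length := by
  refine (Nat.lt_size_self k).trans_le (Nat.pow_le_pow_right (by norm_num) ?_)
  have : ∀ l : List Bool, l.length ≤ (l.flatMap fun b => [true, b]).length := by
    intro l
    induction l with
    | nil => simp
    | cons b l ih =>
      rw [List.flatMap_cons, List.length_append, List.length_cons]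
      simp only [List.length_cons, List.length_nil]
      omega
  rw [← Nat.size_eq_bits_len, natCode, List.length_append]
  exact (this _).trans (Nat.le_add_right _ _)

theorem abs_le_two_pow_length_ratCode (a : ℚ) : |a| ≤ 2 ^ (ratCode a).length := by
  have h1 : |a| ≤ (a.num.natAbs : ℚ) := by
    have h2 : (1 : ℚ) ≤ a.den := by exact_mod_cast a.den_pos
    rw [Nat.cast_natAbs, Int.cast_abs, ← Rat.mul_den_eq_num a, abs_mul]
    exact le_mul_of_one_le_right (abs_nonneg _) (h2.trans (le_abs_self _))
  have h3 : (a.num.natAbs : ℚ) ≤ 2 ^ (natCode a.num.natAbs).length := by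
    exact_mod_cast (lt_two_pow_length_natCode a.num.natAbs).le
  refine h1.trans (h3.trans (pow_le_pow_right₀ (by norm_num) ?_))
  rw [ratCode, List.length_cons, List.length_append]
  omega

theorem length_le_length_flatMap {α β : Type} {l : List α} {f : α → List β} {a : α}
    (ha : a ∈ l) : (f a).length ≤ (l.flatMap f).length := by
  rw [List.length_flatMap]
  exact List.le_sum_of_mem (List.mem_map_of_mem ha)

theorem PolyRep.card_support_le {w : List Bool} {p : Poly σ} (h : PolyRep code w p) :
    p.support.card ≤ w.length := by
  classical
  obtain ⟨ms, -, hms, rfl⟩ := h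
  have h1 : p.support.card ≤ ms.length := by
    rw [show p.support = ms.toFinset by ext m; rw [List.mem_toFinset, hms]]
    exact List.toFinset_card_le ms
  have h2 : ∀ l : List (Monom σ),
      l.length ≤ (l.flatMap fun m => true :: (code m ++ ratCode (p.coeff m))).length := by
    intro l
    induction l with
    | nil => simp
    | cons m l ih =>
      rw [List.flatMap_cons, List.length_append, List.length_cons, List.length_cons]
      omega
  rw [List.length_append]
  exact h1.trans ((h2 ms).trans (Nat.le_add_right _ _))

theorem PolyRep.abs_coeff_le {w : List Bool} {p : Poly σ} (h : PolyRep code w p) {μ : Monom σ}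
    (hμ : μ ∈ p.support) : |p.coeff μ| ≤ 2 ^ w.length := by
  obtain ⟨ms, -, hms, rfl⟩ := h
  refine (abs_le_two_pow_length_ratCode _).trans (pow_le_pow_right₀ (by norm_num) ?_)
  have := length_le_length_flatMap
    (f := fun m => true :: (code m ++ ratCode (p.coeff m))) ((hms μ).2 hμ)
  rw [List.length_cons, List.length_append] at this
  rw [List.length_append]
  omega

theorem exists_finset_support_of_forall₂ {ws : List (List Bool)} {ps : List (Poly σ)}
    (h : List.Forall₂ (PolyRep code) ws ps) : ∃ F : Finset (Monom σ),
      F.card ≤ (ws.flatMap fun s => true :: s).length ∧ ∀ p ∈ ps, p.support ⊆ F := by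
  classical
  induction h with
  | nil => exact ⟨∅, by simp, by simp⟩
  | @cons w p ws ps hp _ ih =>
    obtain ⟨F, hF, hsub⟩ := ih
    refine ⟨p.support ∪ F, (Finset.card_union_le _ _).trans ?_, ?_⟩
    · have := hp.card_support_le
      rw [List.flatMap_cons, List.length_append, List.length_cons]
      omega
    · rintro p' (_ | ⟨_, hp'⟩)
      · exact Finset.subset_union_left
      · exact (hsub p' hp').trans Finset.subset_union_right

variable [Fintype σ] {Q : Finset (Poly σ)} {w : List Bool} {π : SOSRefutation Q}

/-- Only the squares and the lifts of `Q` need low degree: the logical axioms vanish under E with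
lifts of any degree. -/
theorem Represents.exists_finset_support (h : Represents code w π) :
    ∃ F : Finset (Monom σ), F.card ≤ w.length ∧ (∀ p ∈ π.r, p.support ⊆ F) ∧
      ∀ q, (π.t q).support ⊆ F := by
  classical
  obtain ⟨wr, wt, wu, wv, hr, ht, -, -, rfl⟩ := h
  obtain ⟨F, hF, hsub⟩ := exists_finset_support_of_forall₂ hr
  refine ⟨F ∪ Finset.univ.biUnion fun q => (π.t q).support, ?_,
    fun p hp => (hsub p hp).trans Finset.subset_union_left, fun q =>
      (Finset.subset_biUnion_of_mem (fun q => (π.t q).support) (Finset.mem_univ q)).trans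
        Finset.subset_union_right⟩
  refine (Finset.card_union_le _ _).trans ?_
  have h1 : (Finset.univ.biUnion fun q => (π.t q).support).card ≤
      ((Finset.univ : Finset {q // q ∈ Q}).toList.flatMap wt).length := by
    rw [List.length_flatMap, Finset.sum_map_toList]
    exact Finset.card_biUnion_le.trans (Finset.sum_le_sum fun q _ => (ht q).card_support_le)
  simp only [List.length_append] at h1 ⊢
  omega

theorem Represents.sum_abs_coeff_le (h : Represents code w π) :
    ∑ q, ∑ μ ∈ (π.t q).support, |(π.t q).coeff μ| ≤ w.length * 2 ^ w.length := by
  obtain ⟨wr, wt, wu, wv, -, ht, -, -, rfl⟩ := h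
  set l := ((Finset.univ : Finset {q // q ∈ Q}).toList.flatMap wt).length with hl
  have hlsum : l = ∑ q, (wt q).length := by
    rw [hl, List.length_flatMap, Finset.sum_map_toList]
  have h1 : ∑ q, ∑ μ ∈ (π.t q).support, |(π.t q).coeff μ| ≤ (l : ℚ) * 2 ^ l := by
    rw [hlsum, Nat.cast_sum, Finset.sum_mul]
    refine Finset.sum_le_sum fun q _ => ?_
    have hq : (wt q).length ≤ ∑ q, (wt q).length :=
      Finset.single_le_sum (f := fun q => (wt q).length) (fun _ _ => Nat.zero_le _)
        (Finset.mem_univ q)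
    have h2 := Finset.sum_le_card_nsmul (π.t q).support (fun μ => |(π.t q).coeff μ|)
      (2 ^ ∑ q, (wt q).length) fun μ hμ =>
        ((ht q).abs_coeff_le hμ).trans (pow_le_pow_right₀ (by norm_num) hq)
    rw [nsmul_eq_mul] at h2
    refine h2.trans (mul_le_mul_of_nonneg_right ?_ (by positivity))
    exact_mod_cast (ht q).card_support_le
  have hle : l ≤ ((wr.flatMap fun s => true :: s) ++ [false]
      ++ (Finset.univ : Finset {q // q ∈ Q}).toList.flatMap wt
      ++ (Finset.univ : Finset σ).toList.flatMap wu
      ++ (Finset.univ : Finset σ).toList.flatMap wv).length := by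
    simp only [List.length_append]
    omega
  refine h1.trans (mul_le_mul (by exact_mod_cast hle) (pow_le_pow_right₀ (by norm_num) hle)
    (by positivity) (by positivity))

end Length

/-! ### Combining the monomial count with the coefficient bound. -/

/-- Every refutation of `Q_n` has either many monomials or large coefficients. -/
theorem two_pow_le_length {n : ℕ} (hn : 48 ≤ n) {code : Monom (Idx n) → List Bool}
    {π : SOSRefutation (Q n)} {w : List Bool} (h : Represents code w π) :
    2 ^ (n / 48) ≤ w.length := by
  by_contra! hlt
  obtain ⟨F, hF, hr, ht⟩ := h.exists_finset_support
  have hE : 1 ≤ n / 48 := by omega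
  -- With E = n / 48, the choice D = 3E works because 2 · 27 < 64. The degree is then d = 4D = 12E,
  -- and 2d = 24E ≤ n - n / 2 explains the 48.
  have hcount : F.card * 3 ^ (3 * (n / 48)) < 4 ^ (3 * (n / 48)) := by
    calc F.card * 3 ^ (3 * (n / 48)) < 2 ^ (n / 48) * 3 ^ (3 * (n / 48)) :=
          Nat.mul_lt_mul_of_pos_right (hF.trans_lt hlt) (by positivity)
      _ = 54 ^ (n / 48) := by rw [pow_mul, ← mul_pow]; norm_num
      _ ≤ 64 ^ (n / 48) := Nat.pow_le_pow_left (by norm_num) _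
      _ = 4 ^ (3 * (n / 48)) := by rw [pow_mul]; norm_num
  obtain ⟨ρ, hcard, hone, hρ⟩ := exists_restriction F hcount
  have h1 := two_pow_le_sum_abs_coeff π hcard hone (d := 4 * (3 * (n / 48))) (by omega) (by omega)
    (fun p hp μ hμ => hρ μ (hr p hp hμ)) (fun q μ hμ => hρ μ (ht q hμ))
  have h2 : (2 : ℚ) ^ 2 ^ n ≤ w.length * 2 ^ w.length := h1.trans h.sum_abs_coeff_le
  have h3 : 2 ^ 2 ^ n ≤ w.length * 2 ^ w.length := by exact_mod_cast h2
  -- Comparing exponents then gives 2^n < 2|w|, against |w| < 2^(n / 48).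
  have h4 : w.length * 2 ^ w.length < 2 ^ (w.length + w.length) := by
    rw [pow_add]
    exact Nat.mul_lt_mul_of_pos_right Nat.lt_two_pow_self (by positivity)
  have h5 := (Nat.pow_lt_pow_iff_right (by norm_num)).1 (h3.trans_lt h4)
  have h6 : 2 ^ (n / 48 + 1) ≤ 2 ^ n := Nat.pow_le_pow_right (by norm_num) (by omega)
  rw [pow_succ] at h6
  omega

end SOSBits

theorem mainTheorem2 :
    ∃ c : ℝ, 0 < c ∧ ∃ N : ℕ, ∀ n : ℕ, N ≤ n →
      ∀ code : SOSBits.Monom (SOSBits.Idx n) → List Bool, SOSBits.IsPrefixCode code →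
        ∀ π : SOSBits.SOSRefutation (SOSBits.Q n),
          (2 : ℝ) ^ (c * (n : ℝ)) ≤ (π.bitComplexity code : ℝ) := by
  -- The slack between 1/100 and 1/48 absorbs the rounding in `n / 48`.
  refine ⟨1 / 100, by norm_num, 100, fun n hn code _ π => ?_⟩
  obtain ⟨w, hw, hlen⟩ := π.bitComplexity_spec code
  have h1 : ((2 ^ (n / 48) : ℕ) : ℝ) ≤ w.length :=
    Nat.cast_le.2 (SOSBits.two_pow_le_length (by omega) hw)
  rw [← hlen]
  refine le_trans ?_ h1
  rw [Nat.cast_pow, Nat.cast_ofNat, ← Real.rpow_natCast]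
  refine Real.rpow_le_rpow_of_exponent_le (by norm_num) ?_
  have h2 : n ≤ 100 * (n / 48) := by omega
  have h3 : (n : ℝ) ≤ 100 * ((n / 48 : ℕ) : ℝ) := by exact_mod_cast h2
  linarith
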